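/- All systems are finite-dimensional complex Hilbert spaces and channels are completely positive trace-preserving maps. A channel $\mathcal N:A'\to B$ is \emph{anti-degradable} if $\mathcal N=\mathcal M\circ\mathcal N_c$ for some channel $\mathcal M:E\to B$, where $\mathcal N_c(X)=\operatorname{Tr}_B(UXU^\dagger)$ is the complementary channel given by an isometric extension $U:A'\to B\otimes E$ of $\mathcal N$, that is, $U^\dagger U=1$ and $\mathcal N(X)=\operatorname{Tr}_E(UXU^\dagger)$. The purified distance is $P(\rho,\xi)=\sqrt{1-F(\rho,\xi)^2}$ with $F(\rho,\xi)=\operatorname{Tr}\sqrt{\sqrt\rho\,\xi\sqrt\rho}$. An $(n,\varepsilon)$ \emph{entanglement generation code} of dimension $d=|A|=|R|$ for $\mathcal N$ consists of a pure state $|\psi\rangle$ of $A'^{\otimes n}\otimes R$ and a decoding channel $\mathcal D:B^{\otimes n}\to A$ such that $$P\bigl(|\Phi\rangle\langle\Phi|,\ ((\mathcal D\circ\mathcal N^{\otimes n})\otimes\mathrm{id}_R)(|\psi\rangle\langle\psi|)\bigr)\le\varepsilon,$$ where $|\Phi\rangle=d^{-1/2}\sum_{i=1}^d|i\rangle|i\rangle$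 is the maximally entangled state of $A\otimes R$. Let $N(n,\varepsilon)$ be the largest dimension $d$ of such a code. \textbf{Theorem.} Let $\mathcal N:A'\to B$ be an anti-degradable channel with $A'\neq 0$ and let $0\le\varepsilon<1/\sqrt2$. Then, for every integer $n\ge 0$, the maximum $N(n,\varepsilon)$ exists and $$\log_2 N(n,\varepsilon)\le\log_2\frac{1}{\cos(2\alpha)},\qquad \alpha=\arcsin\varepsilon .$$ -/

import Mathlib

open scoped Matrix MatrixOrder ComplexOrder

noncomputable section

namespace QInfo

/-- `Φ ⊗ id_R`, acting on operators of the composite system `A ⊗ R`. -/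
def tensorId {A B : Type*} (R : Type*) (Φ : Matrix A A ℂ →ₗ[ℂ] Matrix B B ℂ)
    (X : Matrix (A × R) (A × R) ℂ) : Matrix (B × R) (B × R) ℂ :=
  Matrix.of fun x y => Φ (Matrix.of fun a a' => X (a, x.2) (a', y.2)) x.1 y.1

/-- Complete positivity: `Φ ⊗ id` on `A ⊗ ℂᵏ` preserves positive semidefiniteness, for all `k`. -/
def IsCompletelyPositive {A B : Type*} (Φ : Matrix A A ℂ →ₗ[ℂ] Matrix B B ℂ) : Prop :=
  ∀ (k : ℕ) (X : Matrix (A × Fin k) (A × Fin k) ℂ),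
    X.PosSemidef → (tensorId (Fin k) Φ X).PosSemidef

/-- A quantum channel `A → B`: a completely positive trace-preserving map. The finite types `A` and
`B` index orthonormal bases of the two systems. -/
structure IsQuantumChannel {A B : Type*} [Fintype A] [Fintype B]
    (Φ : Matrix A A ℂ →ₗ[ℂ] Matrix B B ℂ) : Prop where
  completelyPositive : IsCompletelyPositive Φ
  tracePreserving : ∀ X, (Φ X).trace = X.trace

/-- Partial trace over the second factor, as a linear map. -/
def partialTraceRight (B E : Type*) [Fintype E] :
    Matrix (B × E) (B × E) ℂ →ₗ[ℂ] Matrix B B ℂ where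
  toFun X := Matrix.of fun b b' => ∑ e, X (b, e) (b', e)
  map_add' X Y := by ext; simp [Finset.sum_add_distrib]
  map_smul' c X := by ext; simp [Finset.mul_sum]

/-- Partial trace over the first factor, as a linear map. -/
def partialTraceLeft (B E : Type*) [Fintype B] :
    Matrix (B × E) (B × E) ℂ →ₗ[ℂ] Matrix E E ℂ where
  toFun X := Matrix.of fun e e' => ∑ b, X (b, e) (b, e')
  map_add' X Y := by ext; simp [Finset.sum_add_distrib]
  map_smul' c X := by ext; simp [Finset.mul_sum]

/-- The map `X ↦ U X U†`. -/
def conjMap {A C : Type*} [Fintype A] (U : Matrix C A ℂ) :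
    Matrix A A ℂ →ₗ[ℂ] Matrix C C ℂ where
  toFun X := U * X * Uᴴ
  map_add' X Y := by rw [Matrix.mul_add, Matrix.add_mul]
  map_smul' c X := by simp

/-- `U : A → B ⊗ E` is an isometric extension (Stinespring dilation) of `Φ`:
`U† U = 1` and `Φ X = Tr_E (U X U†)`. -/
structure IsIsometricExtension {A B E : Type*} [Fintype A] [DecidableEq A] [Fintype B] [Fintype E]
    (U : Matrix (B × E) A ℂ) (Φ : Matrix A A ℂ →ₗ[ℂ] Matrix B B ℂ) : Prop where
  isometry : Uᴴ * U = 1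
  dilation : Φ = partialTraceRight B E ∘ₗ conjMap U

/-- The complementary channel `X ↦ Tr_B (U X U†)` of the channel with isometric extension `U`. -/
def complementary {A B E : Type*} [Fintype A] [Fintype B] (U : Matrix (B × E) A ℂ) :
    Matrix A A ℂ →ₗ[ℂ] Matrix E E ℂ :=
  partialTraceLeft B E ∘ₗ conjMap U

/-- `Φ` is anti-degradable: `Φ = M ∘ Φ_c` for some channel `M`, where `Φ_c` is the complementary
channel given by an isometric extension of `Φ`. -/
def IsAntiDegradable {A B : Type*} [Fintype A] [DecidableEq A] [Fintype B]
    (Φ : Matrix A A ℂ →ₗ[ℂ] Matrix B B ℂ) : Prop :=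
  ∃ (d : ℕ) (U : Matrix (B × Fin d) A ℂ) (M : Matrix (Fin d) (Fin d) ℂ →ₗ[ℂ] Matrix B B ℂ),
    IsIsometricExtension U Φ ∧ IsQuantumChannel M ∧ Φ = M ∘ₗ complementary U

/-- The tensor power `Φ^{⊗n}`. The product basis of `A^{⊗n}` is indexed by `Fin n → A`, and the map
sends `|a⟩⟨a'|` to `⨂ᵢ Φ(|aᵢ⟩⟨a'ᵢ|)`, extended linearly. -/
def tensorPower {A B : Type*} [Fintype A] [DecidableEq A]
    (Φ : Matrix A A ℂ →ₗ[ℂ] Matrix B B ℂ) (n : ℕ) :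
    Matrix (Fin n → A) (Fin n → A) ℂ →ₗ[ℂ] Matrix (Fin n → B) (Fin n → B) ℂ where
  toFun X := Matrix.of fun b b' =>
    ∑ a, ∑ a', X a a' * ∏ i, Φ (Matrix.single (a i) (a' i) 1) (b i) (b' i)
  map_add' X Y := by ext; simp [add_mul, Finset.sum_add_distrib]
  map_smul' c X := by ext; simp [Finset.mul_sum, mul_assoc]

/-- The operator `|ψ⟩⟨ψ|`. -/
def proj {A : Type*} (ψ : A → ℂ) : Matrix A A ℂ :=
  Matrix.vecMulVec ψ (star ψ)

/-- The maximally entangled vector `d^{-1/2} ∑ᵢ |i⟩|i⟩` of dimension `d`. -/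
def maxEntangled (d : ℕ) : Fin d × Fin d → ℂ :=
  fun x => if x.1 = x.2 then ((Real.sqrt d)⁻¹ : ℝ) else 0

/-- The fidelity `F(ρ, ξ) = Tr √(√ρ ξ √ρ)`. -/
def fidelity {A : Type*} [Fintype A] [DecidableEq A] (ρ ξ : Matrix A A ℂ) : ℝ :=
  (CFC.sqrt (CFC.sqrt ρ * ξ * CFC.sqrt ρ)).trace.re

/-- The purified distance `P(ρ, ξ) = √(1 - F(ρ, ξ)²)`. -/
def purifiedDistance {A : Type*} [Fintype A] [DecidableEq A] (ρ ξ : Matrix A A ℂ) : ℝ :=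
  Real.sqrt (1 - fidelity ρ ξ ^ 2)

/-- There is an `(n, ε)` entanglement generation code of dimension `d = |A| = |R|` for the channel
`Φ`: a pure state `ψ` of `A'ⁿ ⊗ R` and a decoding channel `D : Bⁿ → A` such that
`ξ^{AR} = ((D ∘ Φ^{⊗n}) ⊗ id_R)(|ψ⟩⟨ψ|)` has purified distance at most `ε` from the maximally
entangled state of dimension `d`. -/
def HasCode {A' B : Type*} [Fintype A'] [DecidableEq A'] [Fintype B]
    (Φ : Matrix A' A' ℂ →ₗ[ℂ] Matrix B B ℂ) (n : ℕ) (ε : ℝ) (d : ℕ) : Prop :=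
  ∃ (ψ : (Fin n → A') × Fin d → ℂ)
    (D : Matrix (Fin n → B) (Fin n → B) ℂ →ₗ[ℂ] Matrix (Fin d) (Fin d) ℂ),
    (∑ x, ‖ψ x‖ ^ 2 = 1) ∧ IsQuantumChannel D ∧
      purifiedDistance (proj (maxEntangled d))
        (tensorId (Fin d) (D ∘ₗ tensorPower Φ n) (proj ψ)) ≤ ε

/-- `N(n, ε)`: the largest dimension of an `(n, ε)` entanglement generation code. -/
def maxCodeDim {A' B : Type*} [Fintype A'] [DecidableEq A'] [Fintype B]
    (Φ : Matrix A' A' ℂ →ₗ[ℂ] Matrix B B ℂ) (n : ℕ) (ε : ℝ) : ℕ :=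
  sSup {d : ℕ | HasCode Φ n ε d}

end QInfo

end

noncomputable section

namespace QInfo

open Matrix

/-! Entanglement is monogamous. Anti-degradability lets the environment simulate the output, so for
a code with decoder `D` it can produce the same state `ξ` with the reference `R` by applying `D ∘ₗ
tensorPower M n`. Dilating all channels and decoding on both sides gives one pure state on `A₁ A₂ F
R` whose marginals on `A₁R` and `A₂R` are both `ξ` (`overlap_le_of_decodable_from_environment`).

The maximally entangled projectors on `A₁R` and `A₂R` satisfy `P₁ + P₂ ≤ 1 + 1/d`, so the overlap `c
= ⟨Φ|ξ|Φ⟩` satisfies `2c ≤ 1 + 1/d` (`two_mul_sum_norm_sq_le`). As `Φ` is pure, `F² = c`, and the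
code condition reads `1 - c ≤ ε²`. Hence `d (1 - 2ε²) ≤ 1`, where `1 - 2ε² = cos 2α > 0`. The
maximum exists because this bounds `d` and a one-dimensional code always exists (`hasCode_one`). -/

/-! ### Isometric extensions and Stinespring dilation -/

lemma conjMap_vecMulVec {A C : Type*} [Fintype A] (U : Matrix C A ℂ) (p q : A → ℂ) :
    conjMap U (vecMulVec p (star q)) = vecMulVec (U *ᵥ p) (star (U *ᵥ q)) := by
  simp only [conjMap, LinearMap.coe_mk, AddHom.coe_mk]
  rw [mul_vecMulVec, vecMulVec_mul, star_mulVec]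

lemma partialTraceRight_conjMap_apply {A B E : Type*} [Fintype A] [Fintype E]
    (U : Matrix (B × E) A ℂ) (X : Matrix A A ℂ) (b b' : B) :
    partialTraceRight B E (conjMap U X) b b' =
      ∑ a, ∑ a', X a a' * ∑ e, U (b, e) a * star (U (b', e) a') := by
  simp only [partialTraceRight, conjMap, LinearMap.coe_mk, AddHom.coe_mk, of_apply, mul_apply,
    conjTranspose_apply, Finset.sum_mul, Finset.mul_sum]
  rw [Finset.sum_congr rfl fun _ _ => Finset.sum_comm, Finset.sum_comm]
  refine Finset.sum_congr rfl fun a _ => ?_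
  rw [Finset.sum_comm]
  exact Finset.sum_congr rfl fun a' _ => Finset.sum_congr rfl fun e _ => by ring

/-- An isometric extension can be checked on matrix units. -/
lemma IsIsometricExtension.of_single {A B E : Type*} [Fintype A] [DecidableEq A] [Fintype B]
    [Fintype E] {U : Matrix (B × E) A ℂ} {Φ : Matrix A A ℂ →ₗ[ℂ] Matrix B B ℂ}
    (hU : Uᴴ * U = 1)
    (h : ∀ a a' b b', Φ (single a a' 1) b b' = ∑ e, U (b, e) a * star (U (b', e) a')) :
    IsIsometricExtension U Φ := by
  refine ⟨hU, ?_⟩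
  refine LinearMap.ext fun X => ?_
  ext b b'
  rw [LinearMap.comp_apply, partialTraceRight_conjMap_apply]
  conv_lhs => rw [matrix_eq_sum_single X]
  simp only [map_sum, Matrix.sum_apply]
  refine Finset.sum_congr rfl fun a _ => Finset.sum_congr rfl fun a' _ => ?_
  have : single a a' (X a a') = X a a' • single a a' (1 : ℂ) := by simp
  rw [this, map_smul, Matrix.smul_apply, h, smul_eq_mul]

lemma IsIsometricExtension.apply_vecMulVec {A B E : Type*} [Fintype A] [DecidableEq A] [Fintype B]
    [Fintype E] {U : Matrix (B × E) A ℂ} {Φ : Matrix A A ℂ →ₗ[ℂ] Matrix B B ℂ}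
    (h : IsIsometricExtension U Φ) (p q : A → ℂ) (b b' : B) :
    Φ (vecMulVec p (star q)) b b' = ∑ e, (U *ᵥ p) (b, e) * star ((U *ᵥ q) (b', e)) := by
  rw [h.dilation, LinearMap.comp_apply, conjMap_vecMulVec]
  rfl

lemma IsIsometricExtension.apply_single {A B E : Type*} [Fintype A] [DecidableEq A] [Fintype B]
    [Fintype E] {U : Matrix (B × E) A ℂ} {Φ : Matrix A A ℂ →ₗ[ℂ] Matrix B B ℂ}
    (h : IsIsometricExtension U Φ) (a a' : A) (b b' : B) :
    Φ (single a a' 1) b b' = ∑ e, U (b, e) a * star (U (b', e) a') := by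
  have : single a a' (1 : ℂ) = vecMulVec (Pi.single a 1) (star (Pi.single a' 1)) := by
    ext i j
    simp only [vecMulVec_apply, single_apply, Pi.single_apply, Pi.star_apply]
    grind [star_one, star_zero]
  rw [this, h.apply_vecMulVec]
  simp

/-- The Choi matrix of a completely positive map is positive semidefinite. -/
lemma IsCompletelyPositive.choi_posSemidef {A B : Type*} [Fintype A] [DecidableEq A] [Fintype B]
    {Φ : Matrix A A ℂ →ₗ[ℂ] Matrix B B ℂ} (h : IsCompletelyPositive Φ) :
    (Matrix.of fun x y : B × A => Φ (single x.2 y.2 1) x.1 y.1).PosSemidef := by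
  -- An ancilla of dimension `|A|` suffices; `v` is the unnormalised maximally entangled vector.
  let e := Fintype.equivFin A
  let v : A × Fin (Fintype.card A) → ℂ := fun x => if e x.1 = x.2 then 1 else 0
  have hX := h _ _ (posSemidef_vecMulVec_self_star v)
  convert hX.submatrix (fun x : B × A => (x.1, e x.2)) using 1
  ext x y
  simp only [tensorId, of_apply, submatrix_apply]
  have hs : single x.2 y.2 (1 : ℂ) =
      Matrix.of fun a a' => vecMulVec v (star v) (a, e x.2) (a', e y.2) := by
    ext a a'
    simp only [vecMulVec_apply, single_apply, of_apply, v, Pi.star_apply, e.injective.eq_iff]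
    grind [star_one, star_zero]
  rw [hs]

/-- Stinespring's theorem: every channel has an isometric extension. -/
theorem IsQuantumChannel.exists_isIsometricExtension {A B : Type*} [Fintype A] [DecidableEq A]
    [Fintype B] {Φ : Matrix A A ℂ →ₗ[ℂ] Matrix B B ℂ} (h : IsQuantumChannel Φ) :
    ∃ U : Matrix (B × (B × A)) A ℂ, IsIsometricExtension U Φ := by
  classical
  -- Factor the Choi matrix as `S† S`: each conjugated row of `S` is a Kraus operator, so the rows
  -- index the environment.
  obtain ⟨S, hS⟩ := CStarAlgebra.nonneg_iff_eq_star_mul_self.mp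
    h.completelyPositive.choi_posSemidef.nonneg
  rw [star_eq_conjTranspose] at hS
  have key (a a' : A) (b b' : B) :
      Φ (single a a' 1) b b' = ∑ e, star (S e (b, a)) * star (star (S e (b', a'))) := by
    simpa [mul_apply] using congrFun (congrFun hS (b, a)) (b', a')
  refine ⟨Matrix.of fun x a => star (S x.2 (x.1, a)), .of_single ?_ key⟩
  ext a a'
  -- The `(a, a')` entry of `U† U` is `Tr Φ(|a'⟩⟨a|)`.
  have := h.tracePreserving (single a' a 1)
  simp only [trace, diag_apply, key] at this
  simp only [mul_apply, conjTranspose_apply, of_apply]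
  rw [Fintype.sum_prod_type]
  calc _ = _ := Finset.sum_congr rfl fun b _ => Finset.sum_congr rfl fun e _ => mul_comm _ _
    _ = _ := this
    _ = _ := by simp [single_apply, one_apply, ite_and]

/-! ### Composition, exchange and tensor powers of extensions -/

/-- The isometric extension of a composition built from isometric extensions of the factors. -/
def compExtension {A B C E F : Type*} [Fintype B] (V : Matrix (C × F) B ℂ)
    (U : Matrix (B × E) A ℂ) : Matrix (C × (F × E)) A ℂ :=
  Matrix.of fun x a => ∑ b, V (x.1, x.2.1) b * U (b, x.2.2) a

/-- `V ⊗ 1` preserves inner products; `ι` is the spectator system, which later serves as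
environment, output or reference. -/
lemma sum_star_mul_of_isometry {B C ι : Type*} [Fintype B] [DecidableEq B] [Fintype C] [Fintype ι]
    {V : Matrix C B ℂ} (hV : Vᴴ * V = 1) (p q : B → ι → ℂ) :
    ∑ c, ∑ i, star (∑ b, V c b * p b i) * (∑ b, V c b * q b i) =
      ∑ b, ∑ i, star (p b i) * q b i := by
  have (i : ι) : ∑ c, star (∑ b, V c b * p b i) * (∑ b, V c b * q b i) =
      ∑ b, star (p b i) * q b i := by
    have h : star (V *ᵥ fun b => p b i) ⬝ᵥ (V *ᵥ fun b => q b i) =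
        star (fun b => p b i) ⬝ᵥ fun b => q b i := by
      rw [star_mulVec, ← dotProduct_mulVec, mulVec_mulVec, hV, one_mulVec]
    exact h
  rw [Finset.sum_comm, Finset.sum_congr rfl fun i _ => this i, Finset.sum_comm]

lemma IsIsometricExtension.comp {A B C E F : Type*} [Fintype A] [DecidableEq A] [Fintype B]
    [DecidableEq B] [Fintype C] [Fintype E] [Fintype F]
    {U : Matrix (B × E) A ℂ} {Φ : Matrix A A ℂ →ₗ[ℂ] Matrix B B ℂ}
    {V : Matrix (C × F) B ℂ} {Ψ : Matrix B B ℂ →ₗ[ℂ] Matrix C C ℂ}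
    (hV : IsIsometricExtension V Ψ) (hU : IsIsometricExtension U Φ) :
    IsIsometricExtension (compExtension V U) (Ψ ∘ₗ Φ) := by
  refine .of_single ?_ fun a a' c c' => ?_
  · ext a a'
    rw [← hU.isometry]
    simp only [mul_apply, conjTranspose_apply, compExtension, of_apply, Fintype.sum_prod_type]
    rw [← sum_star_mul_of_isometry hV.isometry (fun b e => U (b, e) a) (fun b e => U (b, e) a')]
    simp only [Fintype.sum_prod_type]
  · rw [LinearMap.comp_apply]
    have : Φ (single a a' 1) =
        ∑ e, vecMulVec (fun b => U (b, e) a) (star fun b => U (b, e) a') := by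
      ext b b'
      rw [hU.apply_single, Matrix.sum_apply]
      rfl
    rw [this, map_sum, Matrix.sum_apply, Fintype.sum_prod_type, Finset.sum_comm]
    refine Finset.sum_congr rfl fun e _ => ?_
    rw [hV.apply_vecMulVec]
    rfl

/-- Exchanging output and environment of an isometric extension. -/
def swapExtension {A B E : Type*} (U : Matrix (B × E) A ℂ) : Matrix (E × B) A ℂ :=
  U.submatrix Prod.swap id

lemma isIsometricExtension_swapExtension {A B E : Type*} [Fintype A] [DecidableEq A] [Fintype B]
    [Fintype E] {U : Matrix (B × E) A ℂ} (hU : Uᴴ * U = 1) :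
    IsIsometricExtension (swapExtension U) (complementary U) := by
  refine ⟨?_, ?_⟩
  · rw [← hU]
    ext a a'
    simp only [mul_apply, conjTranspose_apply, swapExtension, submatrix_apply, id]
    exact (Equiv.prodComm E B).sum_comp fun x => star (U x a) * U x a'
  · rfl

/-- The tensor power `U^{⊗n}`, with the outputs and the environments grouped together. -/
def powExtension {A B E : Type*} (U : Matrix (B × E) A ℂ) (n : ℕ) :
    Matrix ((Fin n → B) × (Fin n → E)) (Fin n → A) ℂ :=
  Matrix.of fun x a => ∏ i, U (x.1 i, x.2 i) (a i)

lemma tensorPower_single {A B : Type*} [Fintype A] [DecidableEq A]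
    (Φ : Matrix A A ℂ →ₗ[ℂ] Matrix B B ℂ) (n : ℕ) (a a' : Fin n → A) (b b' : Fin n → B) :
    tensorPower Φ n (single a a' 1) b b' = ∏ i, Φ (single (a i) (a' i) 1) (b i) (b' i) := by
  simp [tensorPower, single_apply, ite_and]

lemma IsIsometricExtension.tensorPower {A B E : Type*} [Fintype A] [DecidableEq A] [Fintype B]
    [Fintype E] {U : Matrix (B × E) A ℂ} {Φ : Matrix A A ℂ →ₗ[ℂ] Matrix B B ℂ}
    (h : IsIsometricExtension U Φ) (n : ℕ) :
    IsIsometricExtension (powExtension U n) (tensorPower Φ n) := by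
  classical
  refine .of_single ?_ fun a a' b b' => ?_
  · ext a a'
    have h1 (i : Fin n) : ∑ x : B × E, star (U x (a i)) * U x (a' i) =
        (1 : Matrix A A ℂ) (a i) (a' i) := by
      rw [← h.isometry]; rfl
    have h2 := Finset.prod_univ_sum (fun _ : Fin n => (Finset.univ : Finset (B × E)))
      fun i x => star (U x (a i)) * U x (a' i)
    simp only [h1, Fintype.piFinset_univ] at h2
    have h3 : ∏ i, (1 : Matrix A A ℂ) (a i) (a' i) =
        (1 : Matrix (Fin n → A) (Fin n → A) ℂ) a a' := by
      simp only [one_apply, Finset.prod_ite_zero, funext_iff]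
      simp
    rw [← h3, h2, mul_apply]
    rw [← (Equiv.arrowProdEquivProdArrow (Fin n) (fun _ => B) (fun _ => E)).sum_comp]
    refine Finset.sum_congr rfl fun x _ => ?_
    simp [powExtension, Finset.prod_mul_distrib]
  · rw [tensorPower_single]
    simp only [h.apply_single]
    rw [Finset.prod_univ_sum, Fintype.piFinset_univ]
    refine Finset.sum_congr rfl fun x _ => ?_
    simp [powExtension, Finset.prod_mul_distrib]

lemma tensorPower_comp {A B C : Type*} [Fintype A] [DecidableEq A] [Fintype B] [DecidableEq B]
    (Ψ : Matrix B B ℂ →ₗ[ℂ] Matrix C C ℂ) (Φ : Matrix A A ℂ →ₗ[ℂ] Matrix B B ℂ) (n : ℕ) :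
    tensorPower (Ψ ∘ₗ Φ) n = tensorPower Ψ n ∘ₗ tensorPower Φ n := by
  refine Matrix.ext_linearMap ℂ fun a a' => LinearMap.ext_ring ?_
  ext c c'
  simp only [LinearMap.comp_apply, singleLinearMap_apply, tensorPower_single]
  have key (X : Matrix B B ℂ) (c c' : C) :
      Ψ X c c' = ∑ y : B × B, X y.1 y.2 * Ψ (single y.1 y.2 1) c c' := by
    conv_lhs => rw [matrix_eq_sum_single X]
    simp only [map_sum, Matrix.sum_apply, Fintype.sum_prod_type]
    refine Finset.sum_congr rfl fun b _ => Finset.sum_congr rfl fun b' _ => ?_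
    have : single b b' (X b b') = X b b' • single b b' (1 : ℂ) := by simp
    rw [this, map_smul, Matrix.smul_apply, smul_eq_mul]
  rw [Finset.prod_congr rfl fun i _ => key (Φ (single (a i) (a' i) 1)) (c i) (c' i),
    Finset.prod_univ_sum, Fintype.piFinset_univ]
  simp only [QInfo.tensorPower, LinearMap.coe_mk, AddHom.coe_mk, of_apply]
  rw [← Fintype.sum_prod_type'
      (f := fun b b' : Fin n → B => _ * ∏ i, Ψ (single (b i) (b' i) 1) (c i) (c' i)),
    ← (Equiv.arrowProdEquivProdArrow (Fin n) (fun _ => B) (fun _ => B)).sum_comp]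
  refine Finset.sum_congr rfl fun x _ => ?_
  have := tensorPower_single Φ n a a' (fun i => (x i).1) (fun i => (x i).2)
  simp only [QInfo.tensorPower, LinearMap.coe_mk, AddHom.coe_mk, of_apply] at this
  simp [Finset.prod_mul_distrib, this]

/-- Exchanging output and environment commutes with tensor powers, so both sides have the same
dilation. -/
lemma complementary_powExtension {A B E : Type*} [Fintype A] [DecidableEq A] [Fintype B]
    [Fintype E] {U : Matrix (B × E) A ℂ} (hU : Uᴴ * U = 1) (n : ℕ)
    (hUn : (powExtension U n)ᴴ * powExtension U n = 1) :
    complementary (powExtension U n) = tensorPower (complementary U) n := by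
  rw [(isIsometricExtension_swapExtension hUn).dilation,
    ((isIsometricExtension_swapExtension hU).tensorPower n).dilation]
  rfl

/-! ### Fidelity and overlap with the maximally entangled state -/

lemma proj_maxEntangled_mul_self {d : ℕ} (hd : d ≠ 0) :
    proj (maxEntangled d) * proj (maxEntangled d) = proj (maxEntangled d) := by
  have h : star (maxEntangled d) ⬝ᵥ maxEntangled d = 1 := by
    simp only [dotProduct, Fintype.sum_prod_type, maxEntangled, Pi.star_apply]
    have : ((Real.sqrt d : ℝ) : ℂ) ^ 2 = d := by
      rw [← Complex.ofReal_pow, Real.sq_sqrt (Nat.cast_nonneg d), Complex.ofReal_natCast]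
    have hd' : (d : ℂ) ≠ 0 := Nat.cast_ne_zero.mpr hd
    simp [← sq, this, hd', mul_comm]
  rw [proj, vecMulVec_mul_vecMulVec, h, one_smul]

/-- Fidelity of a maximally entangled state with an operator of overlap `c`. -/
lemma fidelity_maxEntangled_sq {d : ℕ} (hd : d ≠ 0)
    (ξ : Matrix (Fin d × Fin d) (Fin d × Fin d) ℂ) {c : ℝ} (hc : 0 ≤ c)
    (h : star (maxEntangled d) ⬝ᵥ (ξ *ᵥ maxEntangled d) = c) :
    fidelity (proj (maxEntangled d)) ξ ^ 2 = c := by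
  have hP := proj_maxEntangled_mul_self hd
  have hP0 : 0 ≤ proj (maxEntangled d) :=
    (posSemidef_vecMulVec_self_star (maxEntangled d)).nonneg
  have hsqrt : CFC.sqrt (proj (maxEntangled d)) = proj (maxEntangled d) :=
    CFC.sqrt_unique hP hP0
  -- Compression by a rank-one projector `P` gives `c P`, so the fidelity is `√c`.
  have hcomp : proj (maxEntangled d) * ξ * proj (maxEntangled d) =
      (c : ℂ) • proj (maxEntangled d) := by
    rw [← h, proj, vecMulVec_mul, vecMulVec_mul_vecMulVec, dotProduct_mulVec]
    ext; simp [vecMulVec_apply]; ring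
  have hsqrt' : CFC.sqrt ((c : ℂ) • proj (maxEntangled d)) =
      ((Real.sqrt c : ℝ) : ℂ) • proj (maxEntangled d) := by
    refine CFC.sqrt_unique ?_ ?_
    · rw [smul_mul_smul_comm, hP, ← Complex.ofReal_mul, Real.mul_self_sqrt hc]
    · exact smul_nonneg (by simp) hP0
  have htr : (proj (maxEntangled d)).trace = 1 := by
    have : ((Real.sqrt d : ℝ) : ℂ) ^ 2 = d := by
      rw [← Complex.ofReal_pow, Real.sq_sqrt (Nat.cast_nonneg d), Complex.ofReal_natCast]
    have hd' : (d : ℂ) ≠ 0 := Nat.cast_ne_zero.mpr hd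
    simp [proj, trace, Fintype.sum_prod_type, vecMulVec_apply, maxEntangled, ← sq, this, hd']
  rw [fidelity, hsqrt, hcomp, hsqrt', trace_smul, htr]
  simp [Real.sq_sqrt hc]

lemma star_maxEntangled_dotProduct {d : ℕ}
    (ξ : Matrix (Fin d × Fin d) (Fin d × Fin d) ℂ) :
    star (maxEntangled d) ⬝ᵥ (ξ *ᵥ maxEntangled d) =
      (d : ℂ)⁻¹ * ∑ r, ∑ r', ξ (r, r) (r', r') := by
  have hd : ((Real.sqrt d : ℝ) : ℂ)⁻¹ * ((Real.sqrt d : ℝ) : ℂ)⁻¹ = (d : ℂ)⁻¹ := by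
    rw [← mul_inv, ← Complex.ofReal_mul, Real.mul_self_sqrt (Nat.cast_nonneg d),
      Complex.ofReal_natCast]
  simp only [dotProduct, mulVec, Fintype.sum_prod_type, maxEntangled, Pi.star_apply, Finset.mul_sum]
  simp only [apply_ite, star_zero, ite_mul, zero_mul, mul_zero, Finset.sum_ite_eq,
    Finset.mem_univ, if_true]
  refine Finset.sum_congr rfl fun r _ => ?_
  simp only [← hd, Complex.ofReal_inv, star_inv₀]
  simp
  refine Finset.sum_congr rfl fun r' _ => ?_
  ring

/-- Overlap of the output of an isometrically extended map with a maximally entangled state. -/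
lemma IsIsometricExtension.overlap {A E : Type*} [Fintype A] [DecidableEq A] [Fintype E] {d : ℕ}
    {U : Matrix (Fin d × E) A ℂ} {Φ : Matrix A A ℂ →ₗ[ℂ] Matrix (Fin d) (Fin d) ℂ}
    (h : IsIsometricExtension U Φ) (ψ : A × Fin d → ℂ) :
    star (maxEntangled d) ⬝ᵥ (tensorId (Fin d) Φ (proj ψ) *ᵥ maxEntangled d) =
      (((d : ℝ)⁻¹ * ∑ e, ‖∑ r, (U *ᵥ fun a => ψ (a, r)) (r, e)‖ ^ 2 : ℝ) : ℂ) := by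
  rw [star_maxEntangled_dotProduct]
  push_cast
  congr 1
  have key (r r' : Fin d) : tensorId (Fin d) Φ (proj ψ) (r, r) (r', r') =
      ∑ e, (U *ᵥ fun a => ψ (a, r)) (r, e) * star ((U *ᵥ fun a => ψ (a, r')) (r', e)) := by
    rw [← h.apply_vecMulVec]
    rfl
  simp only [key]
  rw [Finset.sum_congr rfl fun _ _ => Finset.sum_comm, Finset.sum_comm]
  refine Finset.sum_congr rfl fun e _ => ?_
  rw [← Complex.mul_conj', map_sum, Finset.sum_mul_sum]
  rfl

/-! ### Monogamy of maximal entanglement -/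

lemma norm_sub_mul_add_sq (t : ℝ) (x y z : ℂ) :
    ‖x - t * (y + z)‖ ^ 2 = ‖x‖ ^ 2 - 2 * t * (x * star y).re - 2 * t * (x * star z).re +
      t ^ 2 * (‖y‖ ^ 2 + ‖z‖ ^ 2 + 2 * (y * star z).re) := by
  simp [Complex.sq_norm, Complex.normSq_apply]
  ring

lemma two_mul_re_mul_star_le (x y : ℂ) : 2 * (x * star y).re ≤ ‖x‖ ^ 2 + ‖y‖ ^ 2 := by
  simp [Complex.sq_norm, Complex.normSq_apply]
  nlinarith [sq_nonneg (x.re - y.re), sq_nonneg (x.im - y.im)]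

/-- Two maximally entangled projectors sharing one subsystem: `P₁ + P₂ ≤ 1 + 1/d`. -/
lemma two_mul_sum_norm_sq_le {F : Type*} [Fintype F] {d : ℕ}
    (w : Fin d → Fin d → F → Fin d → ℂ) {S : ℝ}
    (hu : ∑ a, ∑ f, ‖∑ r, w r a f r‖ ^ 2 = S) (hv : ∑ a, ∑ f, ‖∑ r, w a r f r‖ ^ 2 = S)
    (hw : ∑ a, ∑ b, ∑ f, ∑ r, ‖w a b f r‖ ^ 2 = 1) : 2 * S ≤ d + 1 := by
  let u : Fin d → F → ℂ := fun a f => ∑ r, w r a f r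
  let v : Fin d → F → ℂ := fun a f => ∑ r, w a r f r
  have hu' : ∑ a, ∑ f, ‖u a f‖ ^ 2 = S := hu
  have hv' : ∑ a, ∑ f, ‖v a f‖ ^ 2 = S := hv
  -- This `t` minimises `1 - 4tS + 2(d + 1)S t²`, the upper bound for `‖w - t(p + q)‖²` obtained
  -- below.
  let t : ℝ := ((d : ℝ) + 1)⁻¹
  have ht : t * (d + 1) = 1 := inv_mul_cancel₀ (by positivity)
  -- `p = d P₁ w` and `q = d P₂ w`, with `r` indexing the shared subsystem.
  let p : Fin d → Fin d → F → Fin d → ℂ := fun a b f r => if a = r then u b f else 0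
  let q : Fin d → Fin d → F → Fin d → ℂ := fun a b f r => if b = r then v a f else 0
  have hpw : ∑ a, ∑ b, ∑ f, ∑ r, (w a b f r * star (p a b f r)).re = S := by
    rw [← hu, Finset.sum_comm]
    refine Finset.sum_congr rfl fun b _ => ?_
    rw [Finset.sum_comm]
    refine Finset.sum_congr rfl fun f _ => ?_
    rw [← Complex.ofReal_re (_ ^ 2), Complex.ofReal_pow, ← Complex.mul_conj', Finset.sum_mul,
      Complex.re_sum]
    refine Finset.sum_congr rfl fun a _ => ?_
    simp [p, apply_ite, u]
  have hqw : ∑ a, ∑ b, ∑ f, ∑ r, (w a b f r * star (q a b f r)).re = S := by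
    rw [← hv]
    refine Finset.sum_congr rfl fun b _ => ?_
    rw [Finset.sum_comm]
    refine Finset.sum_congr rfl fun f _ => ?_
    rw [← Complex.ofReal_re (_ ^ 2), Complex.ofReal_pow, ← Complex.mul_conj', Finset.sum_mul,
      Complex.re_sum]
    refine Finset.sum_congr rfl fun a _ => ?_
    simp [q, apply_ite, v]
  have hpp : ∑ a, ∑ b, ∑ f, ∑ r, ‖p a b f r‖ ^ 2 = d * S := by
    have : ∀ a b f, ∑ r, ‖p a b f r‖ ^ 2 = ‖u b f‖ ^ 2 := by
      intro a b f
      simp [p, apply_ite]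
    simp only [this, hu']
    simp
  have hqq : ∑ a, ∑ b, ∑ f, ∑ r, ‖q a b f r‖ ^ 2 = d * S := by
    have : ∀ a b f, ∑ r, ‖q a b f r‖ ^ 2 = ‖v a f‖ ^ 2 := by
      intro a b f
      simp [q, apply_ite]
    simp only [this]
    rw [Finset.sum_comm]
    simp only [hv']
    simp
  -- Only `a = b = r` contributes, so the cross term carries no factor `d`, unlike `‖p‖²` and
  -- `‖q‖²`: the two projectors are nearly orthogonal.
  have hpq : ∑ a, ∑ b, ∑ f, ∑ r, 2 * (p a b f r * star (q a b f r)).re ≤ 2 * S := by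
    have h1 : ∀ a b f, ∑ r, 2 * (p a b f r * star (q a b f r)).re =
        if a = b then 2 * (u a f * star (v a f)).re else 0 := by
      intro a b f
      simp only [p, q]
      rw [Finset.sum_eq_single a] <;> grind [star_zero, mul_zero, zero_mul, Complex.zero_re]
    have h2 : ∀ a, ∑ b, ∑ f, (if a = b then 2 * (u a f * star (v a f)).re else 0) =
        ∑ f, 2 * (u a f * star (v a f)).re := by
      intro a
      rw [Finset.sum_comm]
      simp
    simp only [h1, h2]
    have h3 : 2 * S = ∑ a, ∑ f, (‖u a f‖ ^ 2 + ‖v a f‖ ^ 2) := by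
      simp only [Finset.sum_add_distrib, hu', hv']
      ring
    rw [h3]
    refine Finset.sum_le_sum fun a _ => Finset.sum_le_sum fun f _ => ?_
    exact two_mul_re_mul_star_le _ _
  clear_value t p q
  have h0 : 0 ≤ ∑ a, ∑ b, ∑ f, ∑ r, ‖w a b f r - t * (p a b f r + q a b f r)‖ ^ 2 :=
    Finset.sum_nonneg fun a _ => Finset.sum_nonneg fun b _ => Finset.sum_nonneg fun f _ =>
      Finset.sum_nonneg fun r _ => sq_nonneg _
  simp only [norm_sub_mul_add_sq, Finset.sum_add_distrib, Finset.sum_sub_distrib,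
    ← Finset.mul_sum, hw, hpw, hqw, hpp, hqq] at h0
  simp only [← Finset.mul_sum] at hpq
  have h1 := mul_le_mul_of_nonneg_left hpq (sq_nonneg t)
  have h2 : 0 ≤ 1 - 4 * (t * S) + t ^ 2 * (d * S + d * S + 2 * S) := by linarith
  have h3 : t ^ 2 * (d * S + d * S + 2 * S) = 2 * (t * S) := by
    linear_combination 2 * t * S * ht
  have h4 : 2 * S = (d + 1) * (2 * (t * S)) := by linear_combination -2 * S * ht
  rw [h4]
  nlinarith [(Nat.cast_nonneg d : (0 : ℝ) ≤ d)]

/-! ### Decoding from output and environment at once -/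

/-- A map with isometric extensions that differ by an exchange of the output with a copy of it in
the environment has overlap at most `(1 + 1/d) / 2` with a maximally entangled state. -/
lemma overlap_le_of_symmetric_extension {A F : Type*} [Fintype A] [DecidableEq A] [Fintype F]
    {d : ℕ} (hd : d ≠ 0) {G G' : Matrix (Fin d × (Fin d × F)) A ℂ}
    {Φ : Matrix A A ℂ →ₗ[ℂ] Matrix (Fin d) (Fin d) ℂ}
    (hG : IsIsometricExtension G Φ) (hG' : IsIsometricExtension G' Φ)
    (hswap : ∀ a b f x, G' (a, (b, f)) x = G (b, (a, f)) x)
    (ψ : A × Fin d → ℂ) (hψ : ∑ x, ‖ψ x‖ ^ 2 = 1) :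
    ∃ c : ℝ, 0 ≤ c ∧ 2 * (d * c) ≤ d + 1 ∧
      star (maxEntangled d) ⬝ᵥ (tensorId (Fin d) Φ (proj ψ) *ᵥ maxEntangled d) = c := by
  have h1 := hG.overlap ψ
  have h2 := hG'.overlap ψ
  have hd' : (d : ℝ) ≠ 0 := Nat.cast_ne_zero.mpr hd
  refine ⟨_, by positivity, ?_, h1⟩
  rw [mul_inv_cancel_left₀ hd']
  have h12 := h1.symm.trans h2
  rw [Complex.ofReal_inj, mul_right_inj' (inv_ne_zero hd')] at h12
  refine two_mul_sum_norm_sq_le (fun a b f r => (G *ᵥ fun x => ψ (x, r)) (a, (b, f)))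
    (by rw [Fintype.sum_prod_type]) ?_ ?_
  · rw [h12, Fintype.sum_prod_type]
    simp only [mulVec, dotProduct, hswap]
  · have := sum_star_mul_of_isometry hG.isometry (fun x r => ψ (x, r)) (fun x r => ψ (x, r))
    have hn (z : ℂ) : star z * z = ((‖z‖ ^ 2 : ℝ) : ℂ) := by
      rw [Complex.ofReal_pow, ← Complex.conj_mul']
      rfl
    simp only [hn, ← Complex.ofReal_sum, Complex.ofReal_inj] at this
    simp only [Fintype.sum_prod_type] at this hψ
    rw [hψ] at this
    exact this

/-- Applying an isometry to the environment of an isometric extension. -/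
def envExtension {A B C E : Type*} [Fintype E] (V : Matrix C E ℂ) (U : Matrix (B × E) A ℂ) :
    Matrix (B × C) A ℂ :=
  Matrix.of fun x a => ∑ e, V x.2 e * U (x.1, e) a

lemma IsIsometricExtension.env {A B C E : Type*} [Fintype A] [DecidableEq A] [Fintype B]
    [Fintype C] [Fintype E] [DecidableEq E] {U : Matrix (B × E) A ℂ}
    {Φ : Matrix A A ℂ →ₗ[ℂ] Matrix B B ℂ} (hU : IsIsometricExtension U Φ)
    {V : Matrix C E ℂ} (hV : Vᴴ * V = 1) : IsIsometricExtension (envExtension V U) Φ := by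
  refine .of_single ?_ fun a a' b b' => ?_
  · ext a a'
    rw [← hU.isometry]
    simp only [mul_apply, conjTranspose_apply, envExtension, of_apply,
      Fintype.sum_prod_type_right]
    exact sum_star_mul_of_isometry hV (fun e b => U (b, e) a) fun e b => U (b, e) a'
  · rw [hU.apply_single]
    have := sum_star_mul_of_isometry hV (fun e (_ : Unit) => U (b', e) a')
      fun e _ => U (b, e) a
    simp only [Finset.univ_unique, Finset.sum_singleton] at this
    simp only [mul_comm (U (b, _) a), ← this, envExtension, of_apply]
    exact Finset.sum_congr rfl fun c _ => mul_comm _ _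

lemma IsIsometricExtension.reindex {A B E F : Type*} [Fintype A] [DecidableEq A] [Fintype B]
    [Fintype E] [Fintype F] {U : Matrix (B × E) A ℂ} {Φ : Matrix A A ℂ →ₗ[ℂ] Matrix B B ℂ}
    (hU : IsIsometricExtension U Φ) (e : F ≃ E) :
    IsIsometricExtension (U.submatrix (Prod.map id e) id) Φ := by
  refine .of_single ?_ fun a a' b b' => ?_
  · ext a a'
    rw [← hU.isometry]
    simp only [mul_apply, conjTranspose_apply, submatrix_apply, id]
    exact ((Equiv.refl B).prodCongr e).sum_comp fun x => star (U x a) * U x a'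
  · rw [hU.apply_single]
    exact (e.sum_comp fun x => U (b, x) a * star (U (b', x) a')).symm

/-- If the same output can be decoded from the output and from the environment of a channel, then
its overlap with a maximally entangled state is at most `(1 + 1/d) / 2`. -/
lemma overlap_le_of_decodable_from_environment {A B E F F' : Type*} [Fintype A] [DecidableEq A]
    [Fintype B] [DecidableEq B] [Fintype E] [DecidableEq E] [Fintype F] [Fintype F'] {d : ℕ}
    (hd : d ≠ 0) {U : Matrix (B × E) A ℂ} {Φ : Matrix A A ℂ →ₗ[ℂ] Matrix B B ℂ}
    {V : Matrix (Fin d × F) B ℂ} {D : Matrix B B ℂ →ₗ[ℂ] Matrix (Fin d) (Fin d) ℂ}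
    {V' : Matrix (Fin d × F') E ℂ} {D' : Matrix E E ℂ →ₗ[ℂ] Matrix (Fin d) (Fin d) ℂ}
    (hU : IsIsometricExtension U Φ) (hV : IsIsometricExtension V D)
    (hV' : IsIsometricExtension V' D') (h : D ∘ₗ Φ = D' ∘ₗ complementary U)
    (ψ : A × Fin d → ℂ) (hψ : ∑ x, ‖ψ x‖ ^ 2 = 1) :
    ∃ c : ℝ, 0 ≤ c ∧ 2 * (d * c) ≤ d + 1 ∧
      star (maxEntangled d) ⬝ᵥ (tensorId (Fin d) (D ∘ₗ Φ) (proj ψ) *ᵥ maxEntangled d) = c := by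
  -- Both extensions apply `V` to the output and `V'` to the environment of `U`; they differ only in
  -- which decoded system counts as output.
  have h1 := hV.comp (hU.env hV'.isometry)
  have h2 := hV'.comp ((isIsometricExtension_swapExtension hU.isometry).env hV.isometry)
  rw [← h] at h2
  let e₁ : Fin d × (F × F') ≃ F × (Fin d × F') :=
    ⟨fun x => (x.2.1, (x.1, x.2.2)), fun x => (x.2.1, (x.1, x.2.2)), fun _ => rfl, fun _ => rfl⟩
  let e₂ : Fin d × (F × F') ≃ F' × (Fin d × F) :=
    ⟨fun x => (x.2.2, (x.1, x.2.1)), fun x => (x.2.1, (x.2.2, x.1)), fun _ => rfl, fun _ => rfl⟩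
  refine overlap_le_of_symmetric_extension hd (h1.reindex e₁) (h2.reindex e₂) ?_ ψ hψ
  intro a b f x
  simp only [submatrix_apply, compExtension, envExtension, swapExtension, of_apply, Prod.map_apply,
    Prod.swap_prod_mk, id, e₁, e₂, Equiv.coe_fn_mk, Finset.mul_sum]
  rw [Finset.sum_comm]
  exact Finset.sum_congr rfl fun y _ => Finset.sum_congr rfl fun z _ => by ring

/-! ### The dimension bound -/

lemma HasCode.ne_zero {A' B : Type*} [Fintype A'] [DecidableEq A'] [Fintype B]
    {Φ : Matrix A' A' ℂ →ₗ[ℂ] Matrix B B ℂ} {n : ℕ} {ε : ℝ} {d : ℕ} (h : HasCode Φ n ε d) :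
    d ≠ 0 := by
  rintro rfl
  obtain ⟨ψ, D, hψ, -⟩ := h
  simp at hψ

/-- Codes for anti-degradable channels have dimension `d` with `d (1 - 2ε²) ≤ 1`. -/
theorem HasCode.mul_le_one {A' B : Type*} [Fintype A'] [DecidableEq A'] [Fintype B]
    {Φ : Matrix A' A' ℂ →ₗ[ℂ] Matrix B B ℂ} (hanti : IsAntiDegradable Φ) {n : ℕ} {ε : ℝ}
    (hε : 0 ≤ ε) {d : ℕ} (h : HasCode Φ n ε d) : d * (1 - 2 * ε ^ 2) ≤ 1 := by
  classical
  have hd := h.ne_zero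
  obtain ⟨ψ, D, hψ, hD, hP⟩ := h
  obtain ⟨m, U, M, hU, hM, hΦ⟩ := hanti
  obtain ⟨V, hV⟩ := hD.exists_isIsometricExtension
  obtain ⟨W, hW⟩ := hM.exists_isIsometricExtension
  have hUn := hU.tensorPower n
  have hcomp : D ∘ₗ tensorPower Φ n =
      (D ∘ₗ tensorPower M n) ∘ₗ complementary (powExtension U n) := by
    rw [complementary_powExtension hU.isometry n hUn.isometry, LinearMap.comp_assoc,
      ← tensorPower_comp, ← hΦ]
  -- The environment's decoder first applies `M` to each copy, then `D`.
  obtain ⟨c, hc0, hc, hover⟩ := overlap_le_of_decodable_from_environment hd hUn hV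
    (hV.comp (hW.tensorPower n)) hcomp ψ hψ
  rw [purifiedDistance, fidelity_maxEntangled_sq hd _ hc0 hover, Real.sqrt_le_left hε] at hP
  nlinarith [(Nat.cast_nonneg d : (0 : ℝ) ≤ d)]

/-! ### The trivial code -/

/-- The trace as a channel to a one-dimensional system. -/
lemma isQuantumChannel_trace (B : Type*) [Fintype B] :
    ∃ D : Matrix B B ℂ →ₗ[ℂ] Matrix (Fin 1) (Fin 1) ℂ, IsQuantumChannel D := by
  refine ⟨partialTraceRight (Fin 1) B ∘ₗ
    (reindexLinearEquiv ℂ ℂ (Equiv.uniqueProd B (Fin 1)).symm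
      (Equiv.uniqueProd B (Fin 1)).symm).toLinearMap, ?_, ?_⟩
  · intro k X hX
    have : tensorId (Fin k) (partialTraceRight (Fin 1) B ∘ₗ
        (reindexLinearEquiv ℂ ℂ (Equiv.uniqueProd B (Fin 1)).symm
          (Equiv.uniqueProd B (Fin 1)).symm).toLinearMap) X =
        ∑ b : B, X.submatrix (fun x => (b, x.2)) fun x => (b, x.2) := by
      ext x y
      simp [tensorId, partialTraceRight, Matrix.sum_apply]
    rw [this]
    exact posSemidef_sum _ fun b _ => hX.submatrix _
  · intro X
    simp [trace, partialTraceRight]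

lemma IsQuantumChannel.trace_tensorPower {A B : Type*} [Fintype A] [DecidableEq A] [Fintype B]
    {Φ : Matrix A A ℂ →ₗ[ℂ] Matrix B B ℂ} (h : IsQuantumChannel Φ) (n : ℕ)
    (X : Matrix (Fin n → A) (Fin n → A) ℂ) : (tensorPower Φ n X).trace = X.trace := by
  obtain ⟨U, hU⟩ := h.exists_isIsometricExtension
  have hUn := hU.tensorPower n
  have h1 : (partialTraceRight (Fin n → B) _ (conjMap (powExtension U n) X)).trace =
      (conjMap (powExtension U n) X).trace := by
    simp [trace, partialTraceRight, Fintype.sum_prod_type]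
  rw [hUn.dilation, LinearMap.comp_apply, h1]
  simp only [conjMap, LinearMap.coe_mk, AddHom.coe_mk]
  rw [trace_mul_cycle, hUn.isometry, Matrix.one_mul]

/-- For `d = 1` the target is the scalar state `1`; any input followed by the trace reaches it
exactly. -/
lemma hasCode_one {A' B : Type*} [Fintype A'] [DecidableEq A'] [Nonempty A'] [Fintype B]
    {Φ : Matrix A' A' ℂ →ₗ[ℂ] Matrix B B ℂ} (hΦ : IsQuantumChannel Φ) (n : ℕ) {ε : ℝ}
    (hε : 0 ≤ ε) : HasCode Φ n ε 1 := by
  classical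
  obtain ⟨D, hD⟩ := isQuantumChannel_trace (Fin n → B)
  let x₀ : (Fin n → A') × Fin 1 := (fun _ => Classical.arbitrary A', 0)
  have hψ : ∑ x, ‖(Pi.single x₀ 1 : (Fin n → A') × Fin 1 → ℂ) x‖ ^ 2 = 1 := by
    simp [Pi.single_apply, apply_ite]
  refine ⟨Pi.single x₀ 1, D, hψ, hD, ?_⟩
  have hover : star (maxEntangled 1) ⬝ᵥ (tensorId (Fin 1) (D ∘ₗ tensorPower Φ n)
      (proj (Pi.single x₀ 1)) *ᵥ maxEntangled 1) = ((1 : ℝ) : ℂ) := by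
    rw [star_maxEntangled_dotProduct]
    have h1 (Y : Matrix (Fin n → A') (Fin n → A') ℂ) :
        (D ∘ₗ tensorPower Φ n) Y 0 0 = Y.trace := by
      rw [← hΦ.trace_tensorPower, ← hD.tracePreserving]
      simp [trace]
    simp only [tensorId, Finset.univ_unique, Fin.default_eq_zero, Finset.sum_singleton, of_apply,
      h1]
    simp [trace, proj, vecMulVec_apply, Pi.single_apply, x₀]
  rw [purifiedDistance, fidelity_maxEntangled_sq one_ne_zero _ zero_le_one hover]
  simpa using hε

end QInfo

end

theorem mainTheorem2 {A' B : Type*} [Fintype A'] [DecidableEq A'] [Nonempty A'] [Fintype B]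
    (Φ : Matrix A' A' ℂ →ₗ[ℂ] Matrix B B ℂ) (hΦ : QInfo.IsQuantumChannel Φ)
    (hanti : QInfo.IsAntiDegradable Φ)
    (ε : ℝ) (hε0 : 0 ≤ ε) (hε : ε < 1 / Real.sqrt 2) (n : ℕ) :
    IsGreatest {d : ℕ | QInfo.HasCode Φ n ε d} (QInfo.maxCodeDim Φ n ε) ∧
      Real.logb 2 (QInfo.maxCodeDim Φ n ε) ≤
        Real.logb 2 (1 / Real.cos (2 * Real.arcsin ε)) := by
  have hsq : ε ^ 2 < 1 / 2 := by
    have h := pow_lt_pow_left₀ hε hε0 two_ne_zero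
    rwa [div_pow, Real.sq_sqrt zero_le_two, one_pow] at h
  have hcos : Real.cos (2 * Real.arcsin ε) = 1 - 2 * ε ^ 2 := by
    rw [Real.cos_two_mul, Real.cos_arcsin, Real.sq_sqrt (by linarith)]
    ring
  have hpos : 0 < 1 - 2 * ε ^ 2 := by linarith
  have hle {d : ℕ} (h : QInfo.HasCode Φ n ε d) : (d : ℝ) ≤ 1 / (1 - 2 * ε ^ 2) :=
    (le_div_iff₀ hpos).mpr (h.mul_le_one hanti hε0)
  have hbdd : BddAbove {d : ℕ | QInfo.HasCode Φ n ε d} :=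
    ⟨⌊1 / (1 - 2 * ε ^ 2)⌋₊, fun d h => Nat.le_floor (hle h)⟩
  -- A nonempty bounded set of naturals attains its `sSup`, so the default value `0` does not arise.
  have hmem : QInfo.HasCode Φ n ε (QInfo.maxCodeDim Φ n ε) :=
    Nat.sSup_mem ⟨1, QInfo.hasCode_one hΦ n hε0⟩ hbdd
  refine ⟨⟨hmem, fun d hd => le_csSup hbdd hd⟩, ?_⟩
  rw [hcos]
  exact Real.logb_le_logb_of_le one_lt_two (by exact_mod_cast hmem.ne_zero.bot_lt) (hle hmem)
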